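/- For a finite simple graph $G$ with adjacency matrix $A(G)$ and diagonal degree matrix $D(G)$ and for $\alpha\in[0,1)$, let $A_\alpha(G)=\alpha D(G)+(1-\alpha)A(G)$, and let the $\alpha$-spectral radius $\rho_\alpha(G)$ be the spectral radius of $A_\alpha(G)$. Let $\Theta$ be the graph obtained from the complete graph on $\{w_1,w_2,w_3,w_4\}$ by deleting the edge $w_1w_3$. For integers $s,a,b\ge 0$, let $\Theta_5(s;a,b)$ be the graph obtained from $\Theta$ by attaching $s$ pendant edges to $w_2$, a pendant path of length $a$ (that is, with $a$ edges) to $w_1$, and a pendant path of length $b$ to $w_3$; a path of length $0$ adds nothing. Then, for every $\alpha\in[0,1)$, every integer $s\ge 0$ and all integers $a\ge b\ge 1$, $$\rho_\alpha(\Theta_5(s;a,b))>\rho_\alpha(\Theta_5(s;a+1,b-1)).$$ -/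

import Mathlib

namespace AlphaSpectral

/-- The spectral radius `ρ(A)` of a real square matrix: the largest modulus of a complex
eigenvalue.  The spectrum is finite, so the value lies in `[0, ∞)` (see `spectralRadius_ne_top`)
and `ENNReal.toReal` loses nothing. -/
noncomputable def rho {V : Type*} [Fintype V] [DecidableEq V] (A : Matrix V V ℝ) : ℝ :=
  (spectralRadius ℂ (A.map (algebraMap ℝ ℂ))).toReal

theorem spectralRadius_ne_top {V : Type*} [Fintype V] [DecidableEq V] (A : Matrix V V ℝ) :
    spectralRadius ℂ (A.map (algebraMap ℝ ℂ)) ≠ ⊤ := by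
  have hfin : (spectrum ℂ (A.map (algebraMap ℝ ℂ))).Finite := Matrix.finite_spectrum _
  obtain ⟨M, hM⟩ := (hfin.image (fun k : ℂ => ‖k‖₊)).bddAbove
  refine ne_top_of_le_ne_top (b := (M : ENNReal)) ENNReal.coe_ne_top ?_
  refine iSup₂_le fun k hk => ?_
  exact ENNReal.coe_le_coe.2 (hM ⟨k, hk, rfl⟩)

open Classical in
/-- `A_α(G) = α D(G) + (1 - α) A(G)`. -/
noncomputable def alphaMatrix {V : Type*} [Fintype V] (α : ℝ) (G : SimpleGraph V) :
    Matrix V V ℝ :=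
  α • G.degMatrix ℝ + (1 - α) • G.adjMatrix ℝ

open Classical in
/-- The `α`-spectral radius `ρ_α(G) = ρ(A_α(G))`. -/
noncomputable def alphaRho {V : Type*} [Fintype V] (α : ℝ) (G : SimpleGraph V) : ℝ :=
  rho (alphaMatrix α G)

/-- Attach `s` pendant edges at the vertex `r`: each new vertex `inr i` is adjacent to `r` only. -/
def attachPendantEdges {V : Type*} (G : SimpleGraph V) (r : V) (s : ℕ) :
    SimpleGraph (V ⊕ Fin s) where
  Adj x y := match x, y with
    | .inl x, .inl y => G.Adj x y
    | .inl x, .inr _ => x = r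
    | .inr _, .inl y => y = r
    | .inr _, .inr _ => False
  symm := ⟨by
    rintro (x | i) (y | j) h
    · exact G.adj_symm h
    all_goals exact h⟩
  loopless := ⟨by
    rintro (x | i) h
    · exact G.irrefl h
    · exact h⟩

/-- Attach a pendant path of length `k` (that is, with `k` edges) at the vertex `r`: the new
vertices `inr 0, …, inr (k - 1)` are consecutive on the path, and `inr 0` is adjacent to `r`.
For `k = 0` nothing is attached. -/
def attachPendantPath {V : Type*} (G : SimpleGraph V) (r : V) (k : ℕ) :
    SimpleGraph (V ⊕ Fin k) where
  Adj x y := match x, y with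
    | .inl x, .inl y => G.Adj x y
    | .inl x, .inr j => x = r ∧ j.val = 0
    | .inr i, .inl y => y = r ∧ i.val = 0
    | .inr i, .inr j => i.val + 1 = j.val ∨ j.val + 1 = i.val
  symm := ⟨by
    rintro (x | i) (y | j) h
    · exact G.adj_symm h
    · exact h
    · exact h
    · exact Or.symm h⟩
  loopless := ⟨by
    rintro (x | i) h
    · exact G.irrefl h
    · rcases h with h | h <;> omega⟩

/-- The bicyclic graph `Θ` of order `4`, i.e. `K₄` minus an edge.  The vertices `w₁, w₂, w₃, w₄`
are `0, 1, 2, 3`; the non-adjacent vertices `w₁, w₃` have degree `2`, and `w₂, w₄` degree `3`. -/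
def theta : SimpleGraph (Fin 4) :=
  (⊤ : SimpleGraph (Fin 4)).deleteEdges {s(0, 2)}

/-- `Θ₅(s; a, b)`: attach to `Θ` `s` pendant edges at `w₂`, a pendant path of length `a` at `w₁`
and a pendant path of length `b` at `w₃`. -/
def theta5 (s a b : ℕ) : SimpleGraph (((Fin 4 ⊕ Fin s) ⊕ Fin a) ⊕ Fin b) :=
  attachPendantPath
    (attachPendantPath (attachPendantEdges theta 1 s) (.inl 0) a)
    (.inl (.inl 2)) b

end AlphaSpectral

/-! A nonnegative eigenvector `x` of the graph with the less balanced paths is turned into a trial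
vector on the other graph whose Rayleigh quotient exceeds the eigenvalue.

Write the eigenvalue as `β c + 2 α` with `β = 1 - α`, and put `g = α / β`. Along a pendant path the
eigenvalue equation is the recurrence of `q = pathSeq c g`; the fictitious value `q 0 = -g` encodes
that the end vertex has degree one. With `X = x(w₂) + x(w₄)` and `d = pathDen c g`, the equation at
the root of a path of length `k` gives the root the value `X q(k+1) / d(k+1)`.

The trial vector keeps `x` at `w₂`, `w₄` and the pendant vertices, and solves the path and root
equations afresh for the new lengths. Only the equations at `w₂` and `w₄` can then fail
(`theta5_sum_residual`), and the weighted residual is `β X` times the increase of `x(w₁) + x(w₃)`.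
The increase is positive because `q / d` is strictly concave (`ratio_add_lt_ratio_add`): its
increments are a positive constant divided by a product of consecutive terms of the increasing
sequence `d`. The growth of `d` rests on a lower bound for `c` read off from the eigenvector
(`theta5_eigen_bound`). -/

namespace AlphaSpectral

/-! ### Spectral radius of a symmetric matrix and Rayleigh quotients -/

section Rayleigh

variable {V : Type*} [Fintype V] [DecidableEq V]

theorem ofReal_mem_spectrum_map_iff (A : Matrix V V ℝ) (r : ℝ) :
    (r : ℂ) ∈ spectrum ℂ (A.map (algebraMap ℝ ℂ)) ↔ r ∈ spectrum ℝ A := by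
  rw [Matrix.mem_spectrum_iff_isRoot_charpoly, Matrix.mem_spectrum_iff_isRoot_charpoly,
    Matrix.charpoly_map, ← Complex.coe_algebraMap,
    Polynomial.isRoot_map_iff (algebraMap ℝ ℂ).injective]

theorem norm_le_rho (A : Matrix V V ℝ) {k : ℂ}
    (hk : k ∈ spectrum ℂ (A.map (algebraMap ℝ ℂ))) : ‖k‖ ≤ rho A := by
  have h : (‖k‖₊ : ENNReal) ≤ spectralRadius ℂ (A.map (algebraMap ℝ ℂ)) :=
    le_iSup₂ (f := fun (k : ℂ) (_ : k ∈ spectrum ℂ (A.map (algebraMap ℝ ℂ))) =>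
      (‖k‖₊ : ENNReal)) k hk
  have := ENNReal.toReal_mono (spectralRadius_ne_top A) h
  simpa [rho] using this

theorem exists_mem_spectrum_norm_eq_rho [Nonempty V] (A : Matrix V V ℝ) :
    ∃ k ∈ spectrum ℂ (A.map (algebraMap ℝ ℂ)), ‖k‖ = rho A := by
  have hfin : (spectrum ℂ (A.map (algebraMap ℝ ℂ))).Finite := Matrix.finite_spectrum _
  have hne : (spectrum ℂ (A.map (algebraMap ℝ ℂ))).Nonempty :=
    spectrum.nonempty_of_isAlgClosed_of_finiteDimensional ℂ _
  obtain ⟨k, hk, hmax⟩ := hfin.exists_maximalFor (fun k : ℂ => ‖k‖₊) _ hne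
  refine ⟨k, hk, le_antisymm (norm_le_rho A hk) ?_⟩
  have h : spectralRadius ℂ (A.map (algebraMap ℝ ℂ)) ≤ (‖k‖₊ : ENNReal) := by
    refine iSup₂_le fun l hl => ENNReal.coe_le_coe.2 ?_
    rcases le_total ‖l‖₊ ‖k‖₊ with h | h
    · exact h
    · exact hmax hl h
  have := ENNReal.toReal_mono ENNReal.coe_ne_top h
  simpa [rho] using this

theorem posSemidef_rho_sub {A : Matrix V V ℝ} (hA : A.IsHermitian) :
    (algebraMap ℝ (Matrix V V ℝ) (rho A) - A).PosSemidef := by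
  have hH : (algebraMap ℝ (Matrix V V ℝ) (rho A) - A).IsHermitian := by
    refine Matrix.IsHermitian.sub ?_ hA
    rw [Matrix.algebraMap_eq_diagonal]
    exact Matrix.isHermitian_diagonal _
  rw [Matrix.posSemidef_iff_isHermitian_and_spectrum_nonneg]
  refine ⟨hH, fun r hr => ?_⟩
  have h1 : rho A - r ∈ spectrum ℝ A := by
    rw [spectrum.mem_iff] at hr ⊢
    rw [map_sub]
    intro h
    apply hr
    have h2 := h.neg
    convert h2 using 1
    abel
  have h2 := norm_le_rho A ((ofReal_mem_spectrum_map_iff A _).2 h1)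
  rw [Complex.norm_real, Real.norm_eq_abs] at h2
  have := le_abs_self (rho A - r)
  change 0 ≤ r
  linarith

theorem algebraMap_sub_mulVec (A : Matrix V V ℝ) (r : ℝ) (x : V → ℝ) :
    (algebraMap ℝ (Matrix V V ℝ) r - A).mulVec x = r • x - A.mulVec x := by
  rw [Matrix.sub_mulVec, Algebra.algebraMap_eq_smul_one, Matrix.smul_mulVec, Matrix.one_mulVec]

theorem dotProduct_mulVec_le_rho {A : Matrix V V ℝ} (hA : A.IsHermitian) (x : V → ℝ) :
    x ⬝ᵥ A.mulVec x ≤ rho A * (x ⬝ᵥ x) := by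
  have h := (posSemidef_rho_sub hA).dotProduct_mulVec_nonneg x
  rw [algebraMap_sub_mulVec, star_trivial, dotProduct_sub, dotProduct_smul, smul_eq_mul] at h
  linarith

/-- A nonnegative symmetric matrix has a nonnegative eigenvector for its spectral radius. -/
theorem exists_nonneg_mulVec_eq_rho_smul [Nonempty V] {A : Matrix V V ℝ} (hA : A.IsHermitian)
    (h0 : ∀ i j, 0 ≤ A i j) :
    ∃ x : V → ℝ, x ≠ 0 ∧ (∀ v, 0 ≤ x v) ∧ A.mulVec x = rho A • x := by
  obtain ⟨k, hk, hkr⟩ := exists_mem_spectrum_norm_eq_rho A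
  have hB : (A.map (algebraMap ℝ ℂ)).IsHermitian :=
    hA.map _ fun r => by simp
  have hreal : ∃ r : ℝ, (r : ℂ) = k := by
    rw [hB.spectrum_eq_image_range] at hk
    obtain ⟨r, -, hr⟩ := hk
    exact ⟨r, hr⟩
  obtain ⟨r, rfl⟩ := hreal
  rw [Complex.norm_real, Real.norm_eq_abs] at hkr
  rw [ofReal_mem_spectrum_map_iff, spectrum.mem_iff, Matrix.isUnit_iff_isUnit_det,
    isUnit_iff_ne_zero, not_not, ← Matrix.exists_mulVec_eq_zero_iff] at hk
  obtain ⟨x, hx0, hx⟩ := hk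
  rw [algebraMap_sub_mulVec, sub_eq_zero] at hx
  -- By the triangle inequality `rho A * |x| ≤ A |x|` entrywise, so the form of the positive
  -- semidefinite matrix `rho A - A` is nonpositive at `|x|`. It therefore vanishes there, which
  -- puts `|x|` in the kernel.
  refine ⟨fun v => |x v|, ?_, fun v => abs_nonneg _, ?_⟩
  · contrapose! hx0
    ext v
    simpa using congrFun hx0 v
  · have hle : ∀ v, rho A * |x v| ≤ A.mulVec (fun v => |x v|) v := by
      intro v
      have h1 : r * x v = ∑ w, A v w * x w := by
        simpa [Matrix.mulVec, dotProduct] using congrFun hx v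
      rw [← hkr, ← abs_mul, h1]
      refine (Finset.abs_sum_le_sum_abs _ _).trans (le_of_eq ?_)
      simp [Matrix.mulVec, dotProduct, abs_mul, abs_of_nonneg (h0 v _)]
    have hps := posSemidef_rho_sub hA
    have hz : star (fun v => |x v|) ⬝ᵥ
        (algebraMap ℝ (Matrix V V ℝ) (rho A) - A).mulVec (fun v => |x v|) = 0 := by
      refine le_antisymm ?_ (hps.dotProduct_mulVec_nonneg _)
      rw [algebraMap_sub_mulVec, star_trivial]
      refine Finset.sum_nonpos fun v _ => mul_nonpos_of_nonneg_of_nonpos (abs_nonneg _) ?_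
      simpa using hle v
    rw [hps.dotProduct_mulVec_zero_iff, algebraMap_sub_mulVec, sub_eq_zero] at hz
    exact hz.symm

end Rayleigh

/-! ### The operator `A_α` on graphs with pendant edges and paths -/

section Graph

open Classical in
/-- The operator `A_α(G)` with `β` in place of `1 - α`. -/
noncomputable def alphaSum {V : Type*} [Fintype V] (α β : ℝ) (G : SimpleGraph V) (x : V → ℝ)
    (v : V) : ℝ :=
  ∑ w, if G.Adj v w then α * x v + β * x w else 0

theorem alphaMatrix_mulVec {V : Type*} [Fintype V] (α : ℝ) (G : SimpleGraph V) (x : V → ℝ)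
    (v : V) : (alphaMatrix α G).mulVec x v = alphaSum α (1 - α) G x v := by
  classical
  rw [alphaMatrix, Matrix.add_mulVec, Matrix.smul_mulVec, Matrix.smul_mulVec]
  have h1 : (G.degMatrix ℝ).mulVec x v = (∑ w, if G.Adj v w then 1 else 0) * x v := by
    rw [SimpleGraph.degMatrix, Matrix.mulVec_diagonal]
    simp [SimpleGraph.degree, SimpleGraph.neighborFinset_eq_filter]
  have h2 : (G.adjMatrix ℝ).mulVec x v = ∑ w, if G.Adj v w then x w else 0 := by
    simp [Matrix.mulVec, dotProduct, SimpleGraph.adjMatrix_apply]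
  simp only [Pi.add_apply, Pi.smul_apply, smul_eq_mul, alphaSum]
  have e1 : (SimpleGraph.degMatrix ℝ G).mulVec x v = (∑ w, if G.Adj v w then 1 else 0) * x v := by
    convert h1
  have e2 : (SimpleGraph.adjMatrix ℝ G).mulVec x v = ∑ w, if G.Adj v w then x w else 0 := by
    convert h2
  rw [e1, e2, Finset.sum_mul, Finset.mul_sum, Finset.mul_sum, ← Finset.sum_add_distrib]
  refine Finset.sum_congr rfl fun w _ => ?_
  split_ifs <;> ring

theorem alphaMatrix_isHermitian {V : Type*} [Fintype V] (α : ℝ) (G : SimpleGraph V) :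
    (alphaMatrix α G).IsHermitian := by
  classical
  refine Matrix.IsHermitian.ext fun i j => ?_
  by_cases h : i = j
  · subst h; simp
  · simp [alphaMatrix, SimpleGraph.degMatrix, SimpleGraph.adjMatrix_apply, h, Ne.symm h, SimpleGraph.adj_comm]

theorem alphaMatrix_nonneg {V : Type*} [Fintype V] {α : ℝ} (hα0 : 0 ≤ α) (hα1 : α ≤ 1)
    (G : SimpleGraph V) (i j : V) : 0 ≤ alphaMatrix α G i j := by
  classical
  simp only [alphaMatrix, SimpleGraph.degMatrix, SimpleGraph.adjMatrix_apply,
    Matrix.diagonal_apply, Matrix.add_apply, Matrix.smul_apply, smul_eq_mul]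
  refine add_nonneg (mul_nonneg hα0 ?_) (mul_nonneg (by linarith) ?_) <;> split_ifs <;> simp

theorem exists_nonneg_alphaSum_eq {V : Type*} [Fintype V] [Nonempty V] {α : ℝ} (hα0 : 0 ≤ α)
    (hα1 : α ≤ 1) (G : SimpleGraph V) :
    ∃ x : V → ℝ, x ≠ 0 ∧ (∀ v, 0 ≤ x v) ∧
      ∀ v, alphaSum α (1 - α) G x v = alphaRho α G * x v := by
  classical
  obtain ⟨x, h0, h1, h2⟩ := exists_nonneg_mulVec_eq_rho_smul (alphaMatrix_isHermitian α G)
    (alphaMatrix_nonneg hα0 hα1 G)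
  refine ⟨x, h0, h1, fun v => ?_⟩
  rw [← alphaMatrix_mulVec, h2, alphaRho, Pi.smul_apply, smul_eq_mul]

theorem lt_alphaRho_of_sum_pos {V : Type*} [Fintype V] {α t : ℝ} (G : SimpleGraph V) (y : V → ℝ)
    (h : 0 < ∑ v, y v * (alphaSum α (1 - α) G y v - t * y v)) : t < alphaRho α G := by
  classical
  by_contra! hle
  have h1 := dotProduct_mulVec_le_rho (alphaMatrix_isHermitian α G) y
  have h2 : rho (alphaMatrix α G) = alphaRho α G := by
    rw [alphaRho]
  have h3 : 0 ≤ y ⬝ᵥ y := Finset.sum_nonneg fun v _ => mul_self_nonneg _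
  have h4 : ∑ v, y v * (alphaSum α (1 - α) G y v - t * y v) =
      y ⬝ᵥ (alphaMatrix α G).mulVec y - t * (y ⬝ᵥ y) := by
    simp only [dotProduct, alphaMatrix_mulVec, Finset.mul_sum, ← Finset.sum_sub_distrib]
    exact Finset.sum_congr rfl fun v _ => by ring
  rw [h2] at h1
  nlinarith

theorem alphaSum_attachPendantEdges_inl {V : Type*} [Fintype V] [DecidableEq V] (α β : ℝ)
    (G : SimpleGraph V) (r : V) (s : ℕ) (x : V ⊕ Fin s → ℝ) (v : V) :
    alphaSum α β (attachPendantEdges G r s) x (.inl v) =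
      alphaSum α β G (fun w => x (.inl w)) v +
        if v = r then ∑ i, (α * x (.inl v) + β * x (.inr i)) else 0 := by
  rw [alphaSum, Fintype.sum_sum_type, alphaSum]
  congr 1
  by_cases h : v = r <;> simp [attachPendantEdges, h]

theorem alphaSum_attachPendantEdges_inr {V : Type*} [Fintype V] (α β : ℝ)
    (G : SimpleGraph V) (r : V) (s : ℕ) (x : V ⊕ Fin s → ℝ) (i : Fin s) :
    alphaSum α β (attachPendantEdges G r s) x (.inr i) =
      α * x (.inr i) + β * x (.inl r) := by
  classical
  rw [alphaSum, Fintype.sum_sum_type, Finset.sum_eq_single r] <;>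
    simp +contextual [attachPendantEdges]

/-- The contribution of the first vertex of a pendant path at its root. -/
noncomputable def pathTerm {V : Type*} (α β : ℝ) (r : V) {k : ℕ} (x : V ⊕ Fin k → ℝ) : ℝ :=
  if h : 0 < k then α * x (.inl r) + β * x (.inr ⟨0, h⟩) else 0

theorem alphaSum_attachPendantPath_inl {V : Type*} [Fintype V] [DecidableEq V] (α β : ℝ)
    (G : SimpleGraph V) (r : V) (k : ℕ) (x : V ⊕ Fin k → ℝ) (v : V) :
    alphaSum α β (attachPendantPath G r k) x (.inl v) =
      alphaSum α β G (fun w => x (.inl w)) v + if v = r then pathTerm α β r x else 0 := by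
  rw [alphaSum, Fintype.sum_sum_type, alphaSum]
  congr 1
  by_cases h : v = r
  · subst h
    cases k with
    | zero => simp [pathTerm]
    | succ k =>
      rw [Fin.sum_univ_succ]
      simp [attachPendantPath, pathTerm]
  · simp [attachPendantPath, h]

theorem alphaSum_attachPendantPath_inr {V : Type*} [Fintype V] (α β : ℝ)
    (G : SimpleGraph V) (r : V) (k : ℕ) (x : V ⊕ Fin k → ℝ) (z : ℕ → ℝ)
    (hz0 : x (.inl r) = z 0) (hz : ∀ i : Fin k, x (.inr i) = z (i + 1)) (i : Fin k) :
    alphaSum α β (attachPendantPath G r k) x (.inr i) =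
      α * z (i + 1) + β * z i +
        if (i : ℕ) + 1 < k then α * z (i + 1) + β * z (i + 2) else 0 := by
  classical
  rw [alphaSum, Fintype.sum_sum_type]
  have h1 : ∀ (m : ℕ) (t : ℕ → ℝ), (∑ j : Fin k, if m = j.val then t j else 0) =
      if m < k then t m else 0 := by
    intro m t
    split_ifs with h
    · rw [Finset.sum_eq_single (⟨m, h⟩ : Fin k)]
      · simp
      · intro b _ hb
        rw [if_neg]
        rintro rfl
        exact hb rfl
      · simp
    · refine Finset.sum_eq_zero fun j _ => if_neg ?_
      have := j.2
      omega
  -- Separating the outer from the inner neighbour leaves at most one nonzero term in each sum.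
  have hsplit : ∀ j : Fin k, (if (attachPendantPath G r k).Adj (.inr i) (.inr j)
      then α * x (.inr i) + β * x (.inr j) else 0) =
      (if i.val + 1 = j.val then α * z (i + 1) + β * z (j + 1) else 0) +
      (if i.val = j.val + 1 then α * z (i + 1) + β * z (j + 1) else 0) := by
    intro j
    rw [hz i, hz j]
    have hadj : (attachPendantPath G r k).Adj (.inr i) (.inr j) ↔
        i.val + 1 = j.val ∨ j.val + 1 = i.val := Iff.rfl
    simp only [hadj]
    by_cases h1 : i.val + 1 = j.val
    · rw [if_pos (.inl h1), if_pos h1, if_neg (by omega), add_zero]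
    · by_cases h2 : j.val + 1 = i.val
      · rw [if_pos (.inr h2), if_neg h1, if_pos h2.symm, zero_add]
      · rw [if_neg (by omega), if_neg h1, if_neg (by omega), add_zero]
  rw [Finset.sum_congr rfl fun j _ => hsplit j, Finset.sum_add_distrib,
    h1 (i + 1) (fun j => α * z (i + 1) + β * z (j + 1))]
  have hinl : (∑ w, if (attachPendantPath G r k).Adj (.inr i) (.inl w)
      then α * x (.inr i) + β * x (.inl w) else 0) =
      if i.val = 0 then α * z (i + 1) + β * z 0 else 0 := by
    rw [← hz0, hz i]
    by_cases h : i.val = 0 <;> simp [attachPendantPath, h]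
  rw [hinl]
  obtain ⟨m, hm⟩ := i
  cases m with
  | zero => simp [add_comm]
  | succ m =>
    have h2 : (∑ j : Fin k, if m + 1 = j.val + 1 then α * z (m + 1 + 1) + β * z (j + 1) else 0) =
        α * z (m + 1 + 1) + β * z (m + 1) := by
      have := h1 m (fun j => α * z (m + 1 + 1) + β * z (j + 1))
      rw [if_pos (by omega)] at this
      rw [← this]
      refine Finset.sum_congr rfl fun j _ => ?_
      simp
    simp only [h2]
    simp only [Nat.add_eq_zero_iff, one_ne_zero, and_false, if_false, zero_add]
    rw [add_comm, add_assoc (m + 1) 1 1]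

end Graph

/-! ### The recurrence along a path and concavity of `q / d` -/

section PathSequence

/-- The solution of `q (n + 2) = c q (n + 1) - q n` with `q 0 = -g` and `q 1 = 1`: up to a scalar,
the entries of an eigenvector along a pendant path, read from its end vertex. -/
def pathSeq (c g : ℝ) : ℕ → ℝ
  | 0 => -g
  | 1 => 1
  | n + 2 => c * pathSeq c g (n + 1) - pathSeq c g n

/-- The sequence `q (n + 1) - g q n`. -/
def pathDen (c g : ℝ) (n : ℕ) : ℝ := pathSeq c g (n + 1) - g * pathSeq c g n

variable {c g : ℝ}

theorem pathSeq_add_two (n : ℕ) :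
    pathSeq c g (n + 2) = c * pathSeq c g (n + 1) - pathSeq c g n := by
  rw [pathSeq]

theorem pathDen_add_two (n : ℕ) :
    pathDen c g (n + 2) = c * pathDen c g (n + 1) - pathDen c g n := by
  simp only [pathDen, pathSeq_add_two]
  ring

theorem pathDen_one : pathDen c g 1 = c := by
  simp [pathDen, pathSeq]

theorem pathDen_two : pathDen c g 2 = c ^ 2 - 1 - g ^ 2 := by
  simp [pathDen, pathSeq]
  ring

/-- Two consecutive zeros propagate backwards through the recurrence down to `q 1 = 1`. -/
theorem eq_zero_of_pathSeq_mul_eq_zero {e : ℝ} :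
    ∀ k, pathSeq c g (k + 1) * e = 0 → pathSeq c g k * e = 0 → e = 0
  | 0, h, _ => by simpa [pathSeq] using h
  | k + 1, h, h' => by
    refine eq_zero_of_pathSeq_mul_eq_zero k h' ?_
    rw [pathSeq_add_two] at h
    linear_combination c * h' - h

/-- This is the Casoratian of two solutions of one recurrence; it is constant because the
coefficient of the lowest term is `-1`. -/
theorem pathSeq_mul_pathDen_sub (k : ℕ) :
    pathSeq c g (k + 1) * pathDen c g k - pathSeq c g k * pathDen c g (k + 1) =
      1 + g ^ 2 + g * c := by
  induction k with
  | zero => simp [pathDen, pathSeq]; ring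
  | succ k ih => rw [← ih, pathSeq_add_two, pathDen_add_two]; ring

theorem two_lt_of_le (hg : 0 ≤ g) (hc : 0 < c) (hcg : 4 ≤ c * (c - g - 1)) : 2 < c := by
  nlinarith [mul_nonneg hg hc.le]

/-- Since `c > 2`, the recurrence preserves being positive and increasing. The full bound `hcg`
serves the first step, `c < c ^ 2 - 1 - g ^ 2`. -/
theorem pathDen_succ_lt (hg : 0 ≤ g) (hc : 0 < c) (hcg : 4 ≤ c * (c - g - 1)) (k : ℕ) :
    0 < pathDen c g (k + 1) ∧ pathDen c g (k + 1) < pathDen c g (k + 2) := by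
  have hc2 := two_lt_of_le hg hc hcg
  have hcg' : g < c := by
    by_contra! h
    nlinarith
  induction k with
  | zero =>
    rw [zero_add, zero_add, pathDen_one, pathDen_two]
    exact ⟨hc, by nlinarith⟩
  | succ k ih =>
    refine ⟨ih.1.trans ih.2, ?_⟩
    rw [pathDen_add_two (k + 1)]
    nlinarith [ih.1, ih.2]

theorem pathDen_succ_strictMono (hg : 0 ≤ g) (hc : 0 < c) (hcg : 4 ≤ c * (c - g - 1)) :
    StrictMono fun k => pathDen c g (k + 1) :=
  strictMono_nat_of_lt_succ fun k => (pathDen_succ_lt hg hc hcg k).2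

theorem ratio_add_lt_ratio_add (hg : 0 ≤ g) (hc : 0 < c) (hcg : 4 ≤ c * (c - g - 1)) {a b : ℕ}
    (hab : b < a) :
    pathSeq c g (a + 2) / pathDen c g (a + 2) + pathSeq c g (b + 1) / pathDen c g (b + 1) <
      pathSeq c g (a + 1) / pathDen c g (a + 1) + pathSeq c g (b + 2) / pathDen c g (b + 2) := by
  have hpos := fun k => (pathDen_succ_lt hg hc hcg k).1
  have hdiff : ∀ k, pathSeq c g (k + 2) / pathDen c g (k + 2) -
      pathSeq c g (k + 1) / pathDen c g (k + 1) =
      (1 + g ^ 2 + g * c) / (pathDen c g (k + 1) * pathDen c g (k + 2)) := by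
    intro k
    rw [← pathSeq_mul_pathDen_sub (k + 1), div_sub_div _ _ (hpos (k + 1)).ne' (hpos k).ne']
    congr 1
    all_goals ring
  have hlt : (1 + g ^ 2 + g * c) / (pathDen c g (a + 1) * pathDen c g (a + 2)) <
      (1 + g ^ 2 + g * c) / (pathDen c g (b + 1) * pathDen c g (b + 2)) := by
    have hmono := pathDen_succ_strictMono hg hc hcg
    refine div_lt_div_of_pos_left (by positivity) (mul_pos (hpos b) (hpos (b + 1))) ?_
    exact mul_lt_mul (hmono hab) (hmono (Nat.succ_lt_succ hab)).le (hpos (b + 1)) (hpos a).le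
  have h1 := hdiff a
  have h2 := hdiff b
  linarith

end PathSequence

/-! ### Solving the eigenvalue equations along a pendant path -/

section PendantPath

variable {V : Type*} {α β c g : ℝ} {r : V} {k : ℕ}

/-- The choice `q 0 = -g` makes `g * q 1 + q 0` vanish, so the formula also covers the empty path.
-/
theorem pathTerm_eq (hα : α = β * g) {y : V ⊕ Fin k → ℝ} {e : ℝ}
    (h0 : y (.inl r) = pathSeq c g (k + 1) * e)
    (hi : ∀ i : Fin k, y (.inr i) = pathSeq c g (k - i) * e) :
    pathTerm α β r y = β * (g * pathSeq c g (k + 1) + pathSeq c g k) * e := by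
  rw [pathTerm]
  split_ifs with h
  · rw [h0, hi, hα]
    simp
    ring
  · obtain rfl : k = 0 := by omega
    simp [pathSeq]

theorem pathTerm_nonneg (hα : 0 ≤ α) (hβ : 0 ≤ β) {y : V ⊕ Fin k → ℝ} (hy : ∀ v, 0 ≤ y v) :
    0 ≤ pathTerm α β r y := by
  rw [pathTerm]
  split_ifs with h
  · exact add_nonneg (mul_nonneg hα (hy _)) (mul_nonneg hβ (hy _))
  · exact le_rfl

theorem alphaSum_attachPendantPath_inr_of_pathSeq [Fintype V] (hα : α = β * g)
    (G : SimpleGraph V) {y : V ⊕ Fin k → ℝ} {e : ℝ}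
    (h0 : y (.inl r) = pathSeq c g (k + 1) * e)
    (hi : ∀ i : Fin k, y (.inr i) = pathSeq c g (k - i) * e) (i : Fin k) :
    alphaSum α β (attachPendantPath G r k) y (.inr i) = (β * c + 2 * α) * y (.inr i) := by
  rw [alphaSum_attachPendantPath_inr α β G r k y (fun j => pathSeq c g (k + 1 - j) * e) h0
    (fun i => by rw [hi, Nat.add_sub_add_right]), hi i]
  obtain ⟨i, hik⟩ := i
  obtain ⟨m, rfl⟩ := Nat.exists_eq_add_of_lt hik
  simp only
  cases m with
  | zero =>
    have e1 : i + 0 + 1 + 1 - (i + 1) = 1 := by omega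
    have e2 : i + 0 + 1 + 1 - i = 2 := by omega
    have e3 : i + 0 + 1 - i = 1 := by omega
    rw [if_neg (by omega), e1, e2, e3, hα]
    simp [pathSeq]
    ring
  | succ m =>
    have e1 : i + (m + 1) + 1 + 1 - (i + 1) = m + 2 := by omega
    have e2 : i + (m + 1) + 1 + 1 - i = m + 3 := by omega
    have e3 : i + (m + 1) + 1 - i = m + 2 := by omega
    have e4 : i + (m + 1) + 1 + 1 - (i + 2) = m + 1 := by omega
    rw [if_pos (by omega), e1, e2, e3, e4, pathSeq_add_two (m + 1)]
    ring

theorem exists_eq_pathSeq_mul [Fintype V] (hβ : β ≠ 0) (hα : α = β * g) (G : SimpleGraph V)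
    (y : V ⊕ Fin k → ℝ)
    (hy : ∀ i : Fin k, alphaSum α β (attachPendantPath G r k) y (.inr i) =
      (β * c + 2 * α) * y (.inr i)) :
    ∃ e, y (.inl r) = pathSeq c g (k + 1) * e ∧
      ∀ i : Fin k, y (.inr i) = pathSeq c g (k - i) * e := by
  obtain ⟨z, hz0, hz⟩ : ∃ z : ℕ → ℝ, y (.inl r) = z 0 ∧ ∀ i : Fin k, y (.inr i) = z (i + 1) := by
    -- Index `0` is the root and `i + 1` the path vertex `i`; the padding beyond `k` is never read.
    refine ⟨fun j => if h : j - 1 < k ∧ 0 < j then y (.inr ⟨j - 1, h.1⟩) else y (.inl r), ?_, ?_⟩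
    · simp
    · intro i
      simp
  have heq : ∀ i, i < k → α * z (i + 1) + β * z i +
      (if i + 1 < k then α * z (i + 1) + β * z (i + 2) else 0) = (β * c + 2 * α) * z (i + 1) := by
    intro i hi
    rw [← alphaSum_attachPendantPath_inr α β G r k y z hz0 hz ⟨i, hi⟩, hy, hz]
  -- The induction goes from the end vertex towards the root, carrying two adjacent entries.
  have key : ∀ j, j < k → z (k - j) = pathSeq c g (j + 1) * z k ∧
      z (k - (j + 1)) = pathSeq c g (j + 2) * z k := by
    intro j
    induction j with
    | zero =>
      intro hj
      have h := heq (k - 1) (by omega)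
      rw [if_neg (by omega), Nat.sub_add_cancel hj, hα] at h
      refine ⟨by simp [pathSeq], mul_left_cancel₀ hβ ?_⟩
      simp only [pathSeq, zero_add]
      linear_combination h
    | succ j ih =>
      intro hj
      obtain ⟨h1, h2⟩ := ih (by omega)
      refine ⟨h2, mul_left_cancel₀ hβ ?_⟩
      have h := heq (k - (j + 2)) (by omega)
      have e1 : k - (j + 2) + 1 = k - (j + 1) := by omega
      have e2 : k - (j + 2) + 2 = k - j := by omega
      rw [if_pos (by omega), e1, e2, h1, h2] at h
      rw [pathSeq_add_two (j + 1)]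
      linear_combination h
  refine ⟨z k, ?_, fun i => ?_⟩
  · rw [hz0]
    cases k with
    | zero => simp [pathSeq]
    | succ k => simpa using (key k (by omega)).2
  · have h := (key (k - (i + 1)) (by omega)).1
    have e1 : k - (k - (i.val + 1)) = i + 1 := by omega
    have e2 : k - (i.val + 1) + 1 = k - i := by omega
    rw [hz, ← e1, h, e2]

end PendantPath

/-! ### The operator on `Θ` and on `theta5` -/

section Theta

theorem theta_adj (i j : Fin 4) :
    theta.Adj i j ↔ i ≠ j ∧ ¬(i = 0 ∧ j = 2) ∧ ¬(i = 2 ∧ j = 0) := by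
  simp [theta]

theorem alphaSum_theta (α β : ℝ) (x : Fin 4 → ℝ) :
    alphaSum α β theta x 0 = 2 * α * x 0 + β * (x 1 + x 3) ∧
    alphaSum α β theta x 1 = 3 * α * x 1 + β * (x 0 + x 2 + x 3) ∧
    alphaSum α β theta x 2 = 2 * α * x 2 + β * (x 1 + x 3) ∧
    alphaSum α β theta x 3 = 3 * α * x 3 + β * (x 0 + x 1 + x 2) := by
  simp only [alphaSum, Fin.sum_univ_four, theta_adj]
  refine ⟨?_, ?_, ?_, ?_⟩ <;> simp <;> ring

variable {α β : ℝ} {s a b : ℕ} (x : ((Fin 4 ⊕ Fin s) ⊕ Fin a) ⊕ Fin b → ℝ)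

theorem alphaSum_theta5_base (v : Fin 4) :
    alphaSum α β (theta5 s a b) x (.inl (.inl (.inl v))) =
      alphaSum α β theta (fun w => x (.inl (.inl (.inl w)))) v +
      (if v = 1 then
        ∑ i, (α * x (.inl (.inl (.inl v))) + β * x (.inl (.inl (.inr i)))) else 0) +
      (if v = 0 then pathTerm α β (.inl 0) (fun w => x (.inl w)) else 0) +
      (if v = 2 then pathTerm α β (.inl (.inl 2)) x else 0) := by
  rw [theta5, alphaSum_attachPendantPath_inl, alphaSum_attachPendantPath_inl,
    alphaSum_attachPendantEdges_inl]
  simp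

theorem alphaSum_theta5_pendant (i : Fin s) :
    alphaSum α β (theta5 s a b) x (.inl (.inl (.inr i))) =
      α * x (.inl (.inl (.inr i))) + β * x (.inl (.inl (.inl 1))) := by
  rw [theta5, alphaSum_attachPendantPath_inl, alphaSum_attachPendantPath_inl,
    alphaSum_attachPendantEdges_inr]
  simp

theorem alphaSum_theta5_left (i : Fin a) :
    alphaSum α β (theta5 s a b) x (.inl (.inr i)) =
      alphaSum α β (attachPendantPath (attachPendantEdges theta 1 s) (.inl 0) a)
        (fun w => x (.inl w)) (.inr i) := by
  rw [theta5, alphaSum_attachPendantPath_inl]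
  simp

end Theta

/-! ### Eigenvectors of `theta5` and the comparison -/

variable {α β c g : ℝ} {s a b : ℕ}

/-- The eigenvalue equations of `theta5 s a b`, solved along its two pendant paths. -/
theorem theta5_eigen_equations (hβ : β ≠ 0) (hα : α = β * g)
    {x : ((Fin 4 ⊕ Fin s) ⊕ Fin a) ⊕ Fin b → ℝ}
    (hx : ∀ v, alphaSum α β (theta5 s a b) x v = (β * c + 2 * α) * x v) :
    ∃ e f : ℝ,
      x (.inl (.inl (.inl 0))) = pathSeq c g (a + 1) * e ∧
      (∀ i : Fin a, x (.inl (.inr i)) = pathSeq c g (a - i) * e) ∧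
      x (.inl (.inl (.inl 2))) = pathSeq c g (b + 1) * f ∧
      (∀ i : Fin b, x (.inr i) = pathSeq c g (b - i) * f) ∧
      x (.inl (.inl (.inl 1))) + x (.inl (.inl (.inl 3))) = pathDen c g (a + 1) * e ∧
      x (.inl (.inl (.inl 1))) + x (.inl (.inl (.inl 3))) = pathDen c g (b + 1) * f := by
  obtain ⟨e, he0, he⟩ := exists_eq_pathSeq_mul (r := .inl 0) (c := c) hβ hα
    (attachPendantEdges theta 1 s) (fun w => x (.inl w))
    (fun i => by rw [← alphaSum_theta5_left, hx])
  obtain ⟨f, hf0, hf⟩ := exists_eq_pathSeq_mul (V := (Fin 4 ⊕ Fin s) ⊕ Fin a) (r := .inl (.inl 2)) (c := c) hβ hα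
    (attachPendantPath (attachPendantEdges theta 1 s) (.inl 0) a) x
    (fun i => hx (.inr i))
  refine ⟨e, f, he0, he, hf0, hf, ?_, ?_⟩
  · have h := hx (.inl (.inl (.inl 0)))
    rw [alphaSum_theta5_base, (alphaSum_theta α β _).1, pathTerm_eq hα he0 he] at h
    simp only [zero_ne_one, if_false, if_true, add_zero, Fin.reduceEq] at h
    refine mul_left_cancel₀ hβ ?_
    rw [pathDen, pathSeq_add_two]
    linear_combination h + β * c * he0
  · have h := hx (.inl (.inl (.inl 2)))
    rw [alphaSum_theta5_base, (alphaSum_theta α β _).2.2.1, pathTerm_eq hα hf0 hf] at h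
    simp only [if_false, if_true, add_zero, Fin.reduceEq] at h
    refine mul_left_cancel₀ hβ ?_
    rw [pathDen, pathSeq_add_two]
    linear_combination h + β * c * hf0

/-- If the sum vanished, the equation at `w₄` would kill `w₁` and `w₃`, the recurrence would then
kill both paths, and the equation at `w₂` the pendant vertices. -/
theorem theta5_eigen_pos (hβ : 0 < β) (hα : α = β * g)
    {x : ((Fin 4 ⊕ Fin s) ⊕ Fin a) ⊕ Fin b → ℝ} (hx0 : x ≠ 0) (hpos : ∀ v, 0 ≤ x v)
    (hx : ∀ v, alphaSum α β (theta5 s a b) x v = (β * c + 2 * α) * x v) :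
    0 < x (.inl (.inl (.inl 1))) + x (.inl (.inl (.inl 3))) := by
  refine lt_of_le_of_ne (add_nonneg (hpos _) (hpos _)) fun h0 => hx0 ?_
  obtain ⟨e, f, he0, he, hf0, hf, hXe, hXf⟩ := theta5_eigen_equations hβ.ne' hα hx
  have p0 := hpos (.inl (.inl (.inl 0)))
  have p1 := hpos (.inl (.inl (.inl 1)))
  have p2 := hpos (.inl (.inl (.inl 2)))
  have p3 := hpos (.inl (.inl (.inl 3)))
  have z1 : x (.inl (.inl (.inl 1))) = 0 := by linarith
  have z3 : x (.inl (.inl (.inl 3))) = 0 := by linarith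
  have h3 := hx (.inl (.inl (.inl 3)))
  rw [alphaSum_theta5_base, (alphaSum_theta α β _).2.2.2, z1, z3] at h3
  simp only [if_false, add_zero, mul_zero, zero_add, Fin.reduceEq, mul_eq_zero, hβ.ne',
    false_or] at h3
  have z0 : x (.inl (.inl (.inl 0))) = 0 := by linarith
  have z2 : x (.inl (.inl (.inl 2))) = 0 := by linarith
  have path : ∀ {k : ℕ} {w : ℝ}, pathSeq c g (k + 1) * w = 0 → pathDen c g (k + 1) * w = 0 →
      w = 0 := by
    intro k w h1 h2
    refine eq_zero_of_pathSeq_mul_eq_zero k h1 ?_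
    rw [pathDen, pathSeq_add_two] at h2
    linear_combination (c - g) * h1 - h2
  obtain rfl : e = 0 := path (he0.symm.trans z0) (by rw [← hXe, z1, z3, add_zero])
  obtain rfl : f = 0 := path (hf0.symm.trans z2) (by rw [← hXf, z1, z3, add_zero])
  have h1 := hx (.inl (.inl (.inl 1)))
  rw [alphaSum_theta5_base, (alphaSum_theta α β _).2.1, z0, z1, z2, z3] at h1
  simp only [if_false, if_true, add_zero, mul_zero, zero_add, Fin.reduceEq] at h1
  rw [Finset.sum_eq_zero_iff_of_nonneg fun i _ => mul_nonneg hβ.le (hpos _)] at h1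
  funext v
  rcases v with ((v | i) | i) | i
  · fin_cases v
    exacts [z0, z1, z2, z3]
  · exact (mul_eq_zero.1 (h1 i (Finset.mem_univ _))).resolve_left hβ.ne'
  · rw [he i, mul_zero]; rfl
  · rw [hf i, mul_zero]; rfl

/-- Let `X` and `Y` be the sums of `x` over `w₂, w₄` and over `w₁, w₃`. Dropping the nonnegative
pendant contributions, the equations at the two pairs give `2 Y ≤ (c - g - 1) X` and `2 X ≤ c Y`;
eliminating `Y` gives the bound. -/
theorem theta5_eigen_bound (hβ : 0 < β) (hg : 0 ≤ g) (hα : α = β * g)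
    {x : ((Fin 4 ⊕ Fin s) ⊕ Fin a) ⊕ Fin b → ℝ} (hpos : ∀ v, 0 ≤ x v)
    (hX : 0 < x (.inl (.inl (.inl 1))) + x (.inl (.inl (.inl 3))))
    (hx : ∀ v, alphaSum α β (theta5 s a b) x v = (β * c + 2 * α) * x v) :
    0 < c ∧ 4 ≤ c * (c - g - 1) := by
  have hα0 : 0 ≤ α := hα ▸ mul_nonneg hβ.le hg
  have p0 := hpos (.inl (.inl (.inl 0)))
  have p2 := hpos (.inl (.inl (.inl 2)))
  have h0 := hx (.inl (.inl (.inl 0)))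
  have h1 := hx (.inl (.inl (.inl 1)))
  have h2 := hx (.inl (.inl (.inl 2)))
  have h3 := hx (.inl (.inl (.inl 3)))
  rw [alphaSum_theta5_base, (alphaSum_theta α β _).1] at h0
  rw [alphaSum_theta5_base, (alphaSum_theta α β _).2.1] at h1
  rw [alphaSum_theta5_base, (alphaSum_theta α β _).2.2.1] at h2
  rw [alphaSum_theta5_base, (alphaSum_theta α β _).2.2.2] at h3
  simp only [if_false, if_true, add_zero, zero_ne_one, one_ne_zero, Fin.reduceEq] at h0 h1 h2 h3
  have t0 : 0 ≤ pathTerm α β (.inl 0) (fun w => x (.inl w)) :=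
    pathTerm_nonneg hα0 hβ.le fun v => hpos _
  have t2 : 0 ≤ pathTerm α β (.inl (.inl 2)) x := pathTerm_nonneg hα0 hβ.le hpos
  have t1 : 0 ≤ ∑ i, (α * x (.inl (.inl (.inl 1))) + β * x (.inl (.inl (.inr i)))) :=
    Finset.sum_nonneg fun i _ => add_nonneg (mul_nonneg hα0 (hpos _)) (mul_nonneg hβ.le (hpos _))
  set X := x (.inl (.inl (.inl 1))) + x (.inl (.inl (.inl 3))) with hXdef
  set Y := x (.inl (.inl (.inl 0))) + x (.inl (.inl (.inl 2))) with hYdef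
  have hY : 0 ≤ Y := add_nonneg p0 p2
  have hcY : 2 * X ≤ c * Y := by
    refine le_of_mul_le_mul_left ?_ hβ
    rw [hXdef, hYdef]
    linarith
  have hcX : 2 * Y ≤ (c - g - 1) * X := by
    refine le_of_mul_le_mul_left ?_ hβ
    rw [hXdef, hYdef]
    rw [hα] at h1 h3 t1
    linarith
  have hc : 0 < c := by
    by_contra! hle
    nlinarith
  refine ⟨hc, le_of_mul_le_mul_right ?_ hX⟩
  nlinarith

/-- Here `x` need not be an eigenvector: the hypotheses make the eigenvalue equation hold on the
paths, at their roots and at the pendant vertices. -/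
theorem theta5_sum_residual (hα : α = β * g) {x : ((Fin 4 ⊕ Fin s) ⊕ Fin a) ⊕ Fin b → ℝ}
    {e f : ℝ}
    (he0 : x (.inl (.inl (.inl 0))) = pathSeq c g (a + 1) * e)
    (he : ∀ i : Fin a, x (.inl (.inr i)) = pathSeq c g (a - i) * e)
    (hf0 : x (.inl (.inl (.inl 2))) = pathSeq c g (b + 1) * f)
    (hf : ∀ i : Fin b, x (.inr i) = pathSeq c g (b - i) * f)
    (hXe : x (.inl (.inl (.inl 1))) + x (.inl (.inl (.inl 3))) = pathDen c g (a + 1) * e)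
    (hXf : x (.inl (.inl (.inl 1))) + x (.inl (.inl (.inl 3))) = pathDen c g (b + 1) * f)
    (hp : ∀ i : Fin s, α * x (.inl (.inl (.inr i))) + β * x (.inl (.inl (.inl 1))) =
      (β * c + 2 * α) * x (.inl (.inl (.inr i)))) :
    ∑ v, x v * (alphaSum α β (theta5 s a b) x v - (β * c + 2 * α) * x v) =
      x (.inl (.inl (.inl 1))) * (3 * α * x (.inl (.inl (.inl 1))) +
        β * (x (.inl (.inl (.inl 0))) + x (.inl (.inl (.inl 2))) + x (.inl (.inl (.inl 3)))) +
        ∑ i, (α * x (.inl (.inl (.inl 1))) + β * x (.inl (.inl (.inr i)))) -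
        (β * c + 2 * α) * x (.inl (.inl (.inl 1)))) +
      x (.inl (.inl (.inl 3))) * (3 * α * x (.inl (.inl (.inl 3))) +
        β * (x (.inl (.inl (.inl 0))) + x (.inl (.inl (.inl 1))) + x (.inl (.inl (.inl 2)))) -
        (β * c + 2 * α) * x (.inl (.inl (.inl 3)))) := by
  have hA : ∀ i, alphaSum α β (theta5 s a b) x (.inl (.inr i)) =
      (β * c + 2 * α) * x (.inl (.inr i)) := by
    intro i
    rw [alphaSum_theta5_left]
    exact alphaSum_attachPendantPath_inr_of_pathSeq hα (attachPendantEdges theta 1 s)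
      (y := fun w => x (.inl w)) he0 he i
  have hB : ∀ i, alphaSum α β (theta5 s a b) x (.inr i) = (β * c + 2 * α) * x (.inr i) :=
    fun i => alphaSum_attachPendantPath_inr_of_pathSeq hα _ hf0 hf i
  have h0 : alphaSum α β (theta5 s a b) x (.inl (.inl (.inl 0))) =
      (β * c + 2 * α) * x (.inl (.inl (.inl 0))) := by
    rw [alphaSum_theta5_base, (alphaSum_theta α β _).1, pathTerm_eq hα he0 he]
    simp only [if_false, if_true, add_zero, zero_ne_one, Fin.reduceEq]
    rw [pathDen, pathSeq_add_two] at hXe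
    linear_combination β * hXe - β * c * he0
  have h2 : alphaSum α β (theta5 s a b) x (.inl (.inl (.inl 2))) =
      (β * c + 2 * α) * x (.inl (.inl (.inl 2))) := by
    rw [alphaSum_theta5_base, (alphaSum_theta α β _).2.2.1, pathTerm_eq hα hf0 hf]
    simp only [if_false, if_true, add_zero, Fin.reduceEq]
    rw [pathDen, pathSeq_add_two] at hXf
    linear_combination β * hXf - β * c * hf0
  have h1 := alphaSum_theta5_base (α := α) (β := β) x 1
  have h3 := alphaSum_theta5_base (α := α) (β := β) x 3
  rw [(alphaSum_theta α β _).2.1] at h1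
  rw [(alphaSum_theta α β _).2.2.2] at h3
  simp only [if_false, if_true, add_zero, one_ne_zero, Fin.reduceEq] at h1 h3
  simp only [Fintype.sum_sum_type, Fin.sum_univ_four, alphaSum_theta5_pendant, hA, hB, hp, h0, h1,
    h2, h3, sub_self, mul_zero, Finset.sum_const_zero, add_zero, zero_add]

theorem alphaRho_theta5_lt {α : ℝ} (hα0 : 0 ≤ α) (hα1 : α < 1) (s : ℕ) {a b : ℕ} (hab : b < a) :
    alphaRho α (theta5 s (a + 1) b) < alphaRho α (theta5 s a (b + 1)) := by
  obtain ⟨β, hβ⟩ : ∃ β, β = 1 - α := ⟨_, rfl⟩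
  have hβ0 : 0 < β := by linarith
  obtain ⟨g, hg⟩ : ∃ g, g = α / β := ⟨_, rfl⟩
  have hα : α = β * g := by rw [hg]; field_simp
  have hg0 : 0 ≤ g := hg ▸ div_nonneg hα0 hβ0.le
  obtain ⟨c, hc⟩ : ∃ c, alphaRho α (theta5 s (a + 1) b) = β * c + 2 * α :=
    ⟨(alphaRho α (theta5 s (a + 1) b) - 2 * α) / β, by field_simp; ring⟩
  obtain ⟨x, hx0, hpos, hx⟩ := exists_nonneg_alphaSum_eq hα0 hα1.le (theta5 s (a + 1) b)
  rw [hc]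
  rw [hc, ← hβ] at hx
  have hX := theta5_eigen_pos hβ0 hα hx0 hpos hx
  obtain ⟨hc0, hcg⟩ := theta5_eigen_bound hβ0 hg0 hα hpos hX hx
  obtain ⟨e, f, he0, -, hf0, -, hXe, hXf⟩ := theta5_eigen_equations hβ0.ne' hα hx
  have hden := fun k => (pathDen_succ_lt hg0 hc0 hcg k).1
  have h1 := hx (.inl (.inl (.inl 1)))
  have h3 := hx (.inl (.inl (.inl 3)))
  have hp := fun i => hx (.inl (.inl (.inr i)))
  simp only [alphaSum_theta5_pendant] at hp
  rw [alphaSum_theta5_base, (alphaSum_theta α β _).2.1] at h1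
  rw [alphaSum_theta5_base, (alphaSum_theta α β _).2.2.2] at h3
  simp only [if_false, if_true, add_zero, one_ne_zero, Fin.reduceEq] at h1 h3
  set x1 := x (.inl (.inl (.inl 1)))
  set x3 := x (.inl (.inl (.inl 3)))
  set e' := (x1 + x3) / pathDen c g (a + 1) with he'
  set f' := (x1 + x3) / pathDen c g (b + 2) with hf'
  -- The scalars `e'` and `f'` are forced by the root equations at `w₁` and `w₃` for the new lengths
  -- `a` and `b + 1`, with `x1` and `x3` kept.
  let y : ((Fin 4 ⊕ Fin s) ⊕ Fin a) ⊕ Fin (b + 1) → ℝ :=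
    Sum.elim (Sum.elim (Sum.elim
      ![pathSeq c g (a + 1) * e', x1, pathSeq c g (b + 2) * f', x3]
      (fun i => x (.inl (.inl (.inr i)))))
      (fun i => pathSeq c g (a - i) * e'))
      (fun i => pathSeq c g (b + 1 - i) * f')
  refine lt_alphaRho_of_sum_pos _ y ?_
  rw [← hβ, theta5_sum_residual (e := e') (f := f') (x := y) hα rfl (fun _ => rfl) rfl
    (fun _ => rfl) (mul_div_cancel₀ _ (hden a).ne').symm
    (mul_div_cancel₀ _ (hden (b + 1)).ne').symm hp]
  change 0 < x1 * (3 * α * x1 + β * (pathSeq c g (a + 1) * e' + pathSeq c g (b + 2) * f' + x3) +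
    ∑ i, (α * x1 + β * x (.inl (.inl (.inr i)))) - (β * c + 2 * α) * x1) +
    x3 * (3 * α * x3 + β * (pathSeq c g (a + 1) * e' + x1 + pathSeq c g (b + 2) * f') -
      (β * c + 2 * α) * x3)
  have hee : e = (x1 + x3) / pathDen c g (a + 2) := by
    rw [hXe, mul_div_cancel_left₀ _ (hden (a + 1)).ne']
  have hff : f = (x1 + x3) / pathDen c g (b + 1) := by
    rw [hXf, mul_div_cancel_left₀ _ (hden b).ne']
  have hlt := mul_lt_mul_of_pos_left (ratio_add_lt_ratio_add hg0 hc0 hcg hab) hX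
  have hgain : 0 < pathSeq c g (a + 1) * e' + pathSeq c g (b + 2) * f' -
      (x (.inl (.inl (.inl 0))) + x (.inl (.inl (.inl 2)))) := by
    rw [he0, hf0, hee, hff, he', hf', sub_pos]
    refine (Eq.trans_lt ?_ hlt).trans_eq ?_ <;> ring
  have hmain := mul_pos (mul_pos hβ0 hX) hgain
  -- Subtracting the equations of `x` at `w₂` and `w₄`, weighted by `x1` and `x3`, leaves exactly `β
  -- (x1 + x3)` times the gain.
  refine hmain.trans_eq ?_
  linear_combination -x1 * h1 - x3 * h3

end AlphaSpectral

theorem mainTheorem9 (α : ℝ) (hα0 : 0 ≤ α) (hα1 : α < 1) (s a b : ℕ) (hb : 1 ≤ b) (hab : b ≤ a) :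
    AlphaSpectral.alphaRho α (AlphaSpectral.theta5 s a b) >
      AlphaSpectral.alphaRho α (AlphaSpectral.theta5 s (a + 1) (b - 1)) := by
  obtain ⟨b, rfl⟩ := Nat.exists_eq_add_of_le' hb
  exact AlphaSpectral.alphaRho_theta5_lt hα0 hα1 s hab
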